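/- Let $E$ be a Dedekind complete Riesz space. A weak order unit of $E$ is an element $e\ge 0$ such that $|x|\wedge e=0$ implies $x=0$. A conditional expectation operator on $E$ is a positive order continuous linear projection $T$ on $E$ whose range $R(T)$ is a Dedekind complete Riesz subspace of $E$ and which maps weak order units of $E$ to weak order units of $E$. Given such a $T$, the space $E$ is called $T$-universally complete (that is, $E=L^1(T)$) if every upwards directed net $(f_\lambda)$ in $E_+$, for which $(Tf_\lambda)$ is order bounded in the universal completion $E^u$ of $E$, is order convergent in $E$. Let $T$ be a conditional expectation operator on $E$, let $E$ be $T$-universally complete, and let $e$ be a weak order unit of $E$ with $Te=e$. Let $U$ and $V$ be conditional expectation operators on $E$ compatible with $T$, that is, $TU=T=UT$ and $TV=T=VT$. Let $\mathcal B(U)$ be the set of band projections $P$ on $E$ with $Pe\in R(U)$, and define $\mathcal B(V)$ likewise. Write $\cdot$ for the $f$-algebra product with unit $e$: multiplication by $f$ is the unique orthomorphism (order bounded band preserving linear operator) $\pi$ of $E$ with $\pi e=f$, whenever it exists. Let $L^\infty(T)=\{f\in E : |f|\le g \text{ for some } g\in R(T)_+\}$ and, for $f\in L^\infty(T)$, let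 $\|f\|_{T,\infty}=\inf\{g\in R(T)_+ : |f|\le g\}$. Put $$\alpha_T(U,V)=\sup\{\,|TPQe-TPe\cdot TQe| : P\in\mathcal B(U),\ Q\in\mathcal B(V)\},\qquad \varphi_T(U,V)=\sup_{Q\in\mathcal B(V)}\|UQe-TQe\|_{T,\infty}.$$ Then all these quantities are well defined (multiplication by $TPe$ is given by a unique orthomorphism for each $P\in\mathcal B(U)$, $UQe-TQe\in L^\infty(T)$ for each $Q\in\mathcal B(V)$, and both suprema exist in $E$), and $$\alpha_T(U,V)\le\varphi_T(U,V).$$ -/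

import Mathlib

universe u v

namespace RieszMixing

/-! A Dedekind complete Riesz space is a real vector space `E` with a compatible order that is a
conditionally complete lattice: every nonempty set that is bounded above has a least upper bound. -/

section RieszSpaces

variable {E : Type u} [ConditionallyCompleteLattice E] [AddCommGroup E] [IsOrderedAddMonoid E]
  [Module ℝ E] [IsOrderedModule ℝ E]

/-- `e` is a weak order unit: `e ≥ 0` and only `0` is disjoint from `e`. -/
def IsWeakOrderUnit (e : E) : Prop :=
  0 ≤ e ∧ ∀ x : E, |x| ⊓ e = 0 → x = 0

/-- `T` is a conditional expectation operator: a positive order continuous linear projection whose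
range is a Dedekind complete Riesz subspace, mapping weak order units to weak order units. -/
structure IsConditionalExpectation (T : E →ₗ[ℝ] E) : Prop where
  positive : ∀ x : E, 0 ≤ x → 0 ≤ T x
  order_continuous : ∀ D : Set E, D.Nonempty → DirectedOn (· ≥ ·) D → IsGLB D 0 →
    IsGLB (T '' D) 0
  idempotent : ∀ x : E, T (T x) = T x
  range_sup_mem : ∀ x ∈ LinearMap.range T, ∀ y ∈ LinearMap.range T, x ⊔ y ∈ LinearMap.range T
  range_dedekindComplete : ∀ S : Set (LinearMap.range T), S.Nonempty → BddAbove S →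
    ∃ s, IsLUB S s
  map_weakOrderUnit : ∀ e : E, IsWeakOrderUnit e → IsWeakOrderUnit (T e)

variable (E) in
/-- A (Dedekind complete) Riesz space is universally complete if every nonempty set of pairwise
disjoint positive elements has a supremum. -/
def IsUniversallyComplete : Prop :=
  ∀ S : Set E, S.Nonempty → (∀ x ∈ S, 0 ≤ x) → (∀ x ∈ S, ∀ y ∈ S, x ≠ y → x ⊓ y = 0) →
    ∃ s, IsLUB S s

/-- `j` embeds `E` as an order dense Riesz subspace of the universally complete Riesz space `F`,
that is, `F` (with `j`) is a universal completion of `E`. -/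
structure IsUniversalCompletion {F : Type v} [ConditionallyCompleteLattice F] [AddCommGroup F]
    [IsOrderedAddMonoid F] [Module ℝ F] [IsOrderedModule ℝ F] (j : E →ₗ[ℝ] F) : Prop where
  universallyComplete : IsUniversallyComplete F
  injective : Function.Injective j
  map_sup : ∀ x y : E, j (x ⊔ y) = j x ⊔ j y
  order_dense : ∀ y : F, 0 < y → ∃ x : E, 0 < j x ∧ j x ≤ y

/-- `E` is `T`-universally complete: every upwards directed family `D` of positive elements of `E`
for which `T D` is order bounded in the universal completion of `E` converges in order (that is,
has a supremum) in `E`.  The universal completion exists and is unique up to isomorphism, so the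
quantifier over `F` and `j` fixes nothing but a model of it. -/
def IsTUniversallyComplete (T : E →ₗ[ℝ] E) : Prop :=
  ∀ (F : Type u) [ConditionallyCompleteLattice F] [AddCommGroup F] [IsOrderedAddMonoid F]
    [Module ℝ F] [IsOrderedModule ℝ F] (j : E →ₗ[ℝ] F), IsUniversalCompletion j →
    ∀ D : Set E, D.Nonempty → DirectedOn (· ≤ ·) D → (∀ x ∈ D, 0 ≤ x) →
      BddAbove ((fun x => j (T x)) '' D) → ∃ s, IsLUB D s

/-- A band: an order closed solid linear subspace. -/
structure IsBand (B : Submodule ℝ E) : Prop where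
  solid : ∀ x ∈ B, ∀ y : E, |y| ≤ |x| → y ∈ B
  order_closed : ∀ S : Set E, S.Nonempty → S ⊆ B → ∀ s : E, IsLUB S s → s ∈ B

/-- `P` is a band projection: for some band `B`, it is the projection onto `B` along the disjoint
complement of `B`. -/
def IsBandProjection (P : E →ₗ[ℝ] E) : Prop :=
  ∃ B : Submodule ℝ E, IsBand B ∧ ∀ x : E, P x ∈ B ∧ ∀ y ∈ B, |x - P x| ⊓ |y| = 0

/-- `U` is a conditional expectation operator compatible with `T`: `TU = T = UT`. -/
structure IsCompatible (T U : E →ₗ[ℝ] E) : Prop where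
  conditionalExpectation : IsConditionalExpectation U
  comp_left : T ∘ₗ U = T
  comp_right : U ∘ₗ T = T

/-- The set of band projections `P` with `P e` in the range of `U`. -/
def bandProjections (e : E) (U : E →ₗ[ℝ] E) : Set (E →ₗ[ℝ] E) :=
  {P | IsBandProjection P ∧ P e ∈ LinearMap.range U}

/-- An orthomorphism: an order bounded linear operator that preserves disjointness with each
element (equivalently, preserves every band). -/
structure IsOrthomorphism (π : E →ₗ[ℝ] E) : Prop where
  order_bounded : ∀ a : E, ∃ b : E, ∀ x : E, |x| ≤ a → |π x| ≤ b
  band_preserving : ∀ x y : E, |x| ⊓ |y| = 0 → |π x| ⊓ |y| = 0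

open Classical in
/-- The `f`-algebra product `f · g` for which the weak order unit `e` is the algebraic unit.
Multiplication by `f` is the unique orthomorphism of `E` that sends `e` to `f`; it exists as soon
as `f` is `e`-bounded, or is in the range of `T` on a `T`-universally complete space.  The value is
`0` if there is no such orthomorphism. -/
noncomputable def fMul (e f g : E) : E :=
  if h : ∃ π : E →ₗ[ℝ] E, IsOrthomorphism π ∧ π e = f then h.choose g else 0

/-- The space of elements of `E` that are bounded by a positive element of the range of `T`. -/
def LInfty (T : E →ₗ[ℝ] E) : Set E :=
  {f | ∃ g ∈ LinearMap.range T, 0 ≤ g ∧ |f| ≤ g}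

/-- The vector valued norm `‖f‖_{T,∞} = inf {g ∈ R(T)₊ | |f| ≤ g}`, for `f ∈ LInfty T`. -/
noncomputable def normInfty (T : E →ₗ[ℝ] E) (f : E) : E :=
  sInf {g | g ∈ LinearMap.range T ∧ 0 ≤ g ∧ |f| ≤ g}

/-- The elements `|T P Q e - T P e · T Q e|` with `P ∈ B(U)`, `Q ∈ B(V)`. -/
def strongMixingSet (e : E) (T U V : E →ₗ[ℝ] E) : Set E :=
  {x | ∃ P ∈ bandProjections e U, ∃ Q ∈ bandProjections e V,
    x = |T (P (Q e)) - fMul e (T (P e)) (T (Q e))|}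

/-- The conditional strong mixing coefficient `α_T(U, V)`. -/
noncomputable def strongMixing (e : E) (T U V : E →ₗ[ℝ] E) : E :=
  sSup (strongMixingSet e T U V)

/-- The elements `‖U Q e - T Q e‖_{T,∞}` with `Q ∈ B(V)`. -/
def uniformMixingSet (e : E) (T U V : E →ₗ[ℝ] E) : Set E :=
  {x | ∃ Q ∈ bandProjections e V, x = normInfty T (U (Q e) - T (Q e))}

/-- The conditional uniform mixing coefficient `φ_T(U, V)`. -/
noncomputable def uniformMixing (e : E) (T U V : E →ₗ[ℝ] E) : E :=
  sSup (uniformMixingSet e T U V)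

end RieszSpaces

end RieszMixing

open RieszMixing

set_option linter.unusedSectionVars false

/-! For `P ∈ B(U)`, `U` commutes with `P` on `[0, e]` (`comm_of_map_eq`), so `TU = T` gives `TPQe =
TPUQe`. The averaging property (`fMul_map_bandProjection`) gives `TPe · TQe = TPTQe`. The difference
is thus `TP(UQe - TQe)`, whose modulus is at most `T|UQe - TQe| ≤ Tg = g` for every `g ∈ R(T)`
dominating `|UQe - TQe|`; the infimum over `g` yields the bound.

The product takes more work. Multiplication by `f ∈ [0, e]` comes from the Hahn-Banach-Kantorovich
theorem. Uniqueness and averaging both rest on `IsLocalOn`: a map that preserves disjointness on a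
Riesz subspace, is bounded on the order interval of `e` and kills `e` also kills what lies between
`0` and a multiple of `e`. -/

namespace RieszMixing

/-! ### Dominated extension into a Dedekind complete space. -/

section HahnBanach

variable {X : Type v} [AddCommGroup X] [Module ℝ X]
  {E : Type u} [ConditionallyCompleteLattice E] [AddCommGroup E] [IsOrderedAddMonoid E]
  [Module ℝ E] [IsOrderedModule ℝ E]

/-- One-dimensional extension step of the Hahn-Banach-Kantorovich theorem. -/
theorem exists_lt_extension_of_le_sublinear {N : X → E}
    (N_hom : ∀ c : ℝ, 0 < c → ∀ x, N (c • x) = c • N x) (N_add : ∀ x y, N (x + y) ≤ N x + N y)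
    (f : X →ₗ.[ℝ] E) (hf : ∀ x : f.domain, f x ≤ N x) (hdom : f.domain ≠ ⊤) :
    ∃ g, f < g ∧ ∀ x : g.domain, g x ≤ N x := by
  obtain ⟨y, -, hy⟩ : ∃ y ∈ ⊤, y ∉ f.domain := SetLike.exists_of_lt (lt_top_iff_ne_top.2 hdom)
  have key : ∀ x x' : f.domain, f x - N (x - y) ≤ N (x' + y) - f x' := by
    intro x x'
    have h := (hf (x + x')).trans (by
      simpa using N_add ((x : X) - y) (x' + y))
    rw [LinearPMap.map_add] at h
    rw [sub_le_iff_le_add, sub_add_eq_add_sub, le_sub_iff_add_le, add_comm (N (x' + y))]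
    exact h
  -- By `key`, the supremum of these lower bounds is an admissible value at `y`.
  set S : Set E := Set.range fun x : f.domain => f x - N (x - y)
  have hS : BddAbove S := ⟨N ((0 : f.domain) + y) - f 0, by rintro _ ⟨x, rfl⟩; exact key x 0⟩
  have le_c : ∀ x : f.domain, f x - N (x - y) ≤ sSup S := fun x => le_csSup hS ⟨x, rfl⟩
  have c_le : ∀ x : f.domain, sSup S ≤ N (x + y) - f x := fun x =>
    csSup_le (Set.range_nonempty _) (by rintro _ ⟨x', rfl⟩; exact key x' x)
  refine ⟨f.supSpanSingleton y (sSup S) hy, ?_, ?_⟩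
  · refine lt_iff_le_not_ge.2 ⟨f.left_le_sup _ _, fun H => ?_⟩
    replace H := LinearPMap.domain_mono.monotone H
    rw [LinearPMap.domain_supSpanSingleton, sup_le_iff, Submodule.span_le,
      Set.singleton_subset_iff] at H
    exact hy H.2
  · rintro ⟨z, hz⟩
    rcases Submodule.mem_sup.1 hz with ⟨x, hx, y', hy', rfl⟩
    rcases Submodule.mem_span_singleton.1 hy' with ⟨r, rfl⟩
    rw [LinearPMap.supSpanSingleton_apply_mk _ _ _ _ _ hx, RingHom.id_apply]
    rcases lt_trichotomy r 0 with (hr | hr | hr)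
    · have h := le_c ((-r)⁻¹ • ⟨x, hx⟩)
      have hr' : 0 < -r := neg_pos.2 hr
      have h2 := smul_le_smul_of_nonneg_left h hr'.le
      rw [f.map_smul, smul_sub, smul_smul, mul_inv_cancel₀ hr'.ne', one_smul, ← N_hom _ hr'] at h2
      simp only [SetLike.val_smul, smul_sub, smul_smul, mul_inv_cancel₀ hr'.ne', one_smul,
        neg_smul, sub_neg_eq_add] at h2
      rw [sub_le_iff_le_add, neg_add_eq_sub, le_sub_iff_add_le] at h2
      exact h2
    · subst hr
      simpa using hf ⟨x, hx⟩
    · have h := c_le (r⁻¹ • ⟨x, hx⟩)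
      have h2 := smul_le_smul_of_nonneg_left h hr.le
      rw [f.map_smul, smul_sub, smul_smul, mul_inv_cancel₀ hr.ne', one_smul, ← N_hom _ hr] at h2
      simp only [SetLike.val_smul, smul_add, smul_smul, mul_inv_cancel₀ hr.ne', one_smul] at h2
      rw [le_sub_iff_add_le, add_comm] at h2
      exact h2

/-- **Hahn-Banach-Kantorovich theorem**: a partially defined linear map into a Dedekind complete
Riesz space that is dominated by a sublinear map extends to a dominated linear map. -/
theorem exists_extension_of_le_sublinear_lattice (f : X →ₗ.[ℝ] E) (N : X → E)
    (N_hom : ∀ c : ℝ, 0 < c → ∀ x, N (c • x) = c • N x) (N_add : ∀ x y, N (x + y) ≤ N x + N y)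
    (hf : ∀ x : f.domain, f x ≤ N x) :
    ∃ g : X →ₗ[ℝ] E, (∀ x : f.domain, g x = f x) ∧ ∀ x, g x ≤ N x := by
  set S := {p : X →ₗ.[ℝ] E | ∀ x : p.domain, p x ≤ N x}
  have hSc : ∀ c, c ⊆ S → IsChain (· ≤ ·) c → ∀ y ∈ c, ∃ ub ∈ S, ∀ z ∈ c, z ≤ ub := by
    intro c hcs c_chain y hy
    have hcd : DirectedOn (· ≤ ·) c := c_chain.directedOn
    refine ⟨LinearPMap.sSup c hcd, ?_, fun _ ↦ LinearPMap.le_sSup hcd⟩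
    rintro ⟨x, hx⟩
    obtain ⟨g, hgc, hgx⟩ := (LinearPMap.mem_domain_sSup_iff ⟨y, hy⟩ hcd).1 hx
    have hle : g ≤ LinearPMap.sSup c hcd := LinearPMap.le_sSup _ hgc
    rw [← hle.2 (x := ⟨x, hgx⟩) rfl]
    exact hcs hgc ⟨x, hgx⟩
  obtain ⟨q, hpq, hqs, hq⟩ := zorn_le_nonempty₀ S hSc f hf
  have htop : q.domain = ⊤ := by
    by_contra hdom
    obtain ⟨r, hqr, hr⟩ := exists_lt_extension_of_le_sublinear N_hom N_add q hqs hdom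
    exact hqr.not_ge (hq hr hqr.le)
  obtain ⟨q_dom, g⟩ := q
  obtain rfl : q_dom = ⊤ := htop
  refine ⟨g.comp (LinearMap.id.codRestrict ⊤ fun _ ↦ trivial), ?_, ?_⟩
  · exact fun x => (hpq.2 rfl).symm
  · exact fun x => hqs ⟨x, trivial⟩

end HahnBanach

/-! ### Disjointness in lattice ordered groups. -/

section Lattice

variable {E : Type u} [Lattice E] [AddCommGroup E]

theorem inf_eq_zero_of_le {a b c d : E} (ha : 0 ≤ a) (hb : 0 ≤ b) (hac : a ≤ c) (hbd : b ≤ d)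
    (h : c ⊓ d = 0) : a ⊓ b = 0 :=
  le_antisymm (h ▸ inf_le_inf hac hbd) (le_inf ha hb)

variable [IsOrderedAddMonoid E]

theorem add_inf_le_inf_add_inf {a b c : E} (ha : 0 ≤ a) (hb : 0 ≤ b) (hc : 0 ≤ c) :
    (a + b) ⊓ c ≤ a ⊓ c + b ⊓ c := by
  rw [add_inf, inf_add, inf_add]
  refine le_inf (le_inf inf_le_left ?_) (le_inf ?_ ?_)
  · exact inf_le_right.trans (le_add_of_nonneg_right hb)
  · exact inf_le_right.trans (le_add_of_nonneg_left ha)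
  · exact inf_le_right.trans (le_add_of_nonneg_right hc)

theorem add_inf_eq_zero {a b c : E} (ha : 0 ≤ a) (hb : 0 ≤ b) (hc : 0 ≤ c)
    (hac : a ⊓ c = 0) (hbc : b ⊓ c = 0) : (a + b) ⊓ c = 0 :=
  le_antisymm ((add_inf_le_inf_add_inf ha hb hc).trans (by rw [hac, hbc, add_zero]))
    (le_inf (add_nonneg ha hb) hc)

/-- Disjointness turns `||a| - |b||` into `|a| ⊔ |b| = |a| + |b|`; the reverse triangle inequality
does the rest. -/
theorem abs_add_of_disjoint {a b : E} (h : |a| ⊓ |b| = 0) : |a| + |b| ≤ |a + b| := by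
  have h1 := abs_abs_sub_abs_le a (-b)
  rw [abs_neg, sub_neg_eq_add, abs_sub_comm, ← sup_sub_inf_eq_abs_sub, h, sub_zero] at h1
  rwa [← inf_add_sup, h, zero_add]

theorem eq_zero_of_abs_nonpos {a : E} (h : |a| ≤ 0) : a = 0 :=
  le_antisymm ((le_abs_self a).trans h) (neg_nonpos.1 ((neg_le_abs a).trans h))

theorem eq_zero_of_inf_self {a : E} (h : |a| ⊓ |a| = 0) : a = 0 :=
  eq_zero_of_abs_nonpos (by rw [← h, inf_idem])

theorem abs_smul_le_smul [Module ℝ E] [IsOrderedModule ℝ E] {c : ℝ} (hc : 0 ≤ c) {x b : E}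
    (h : |x| ≤ b) : |c • x| ≤ c • b := by
  rw [abs_le'] at h ⊢
  exact ⟨smul_le_smul_of_nonneg_left h.1 hc,
    by rw [← smul_neg]; exact smul_le_smul_of_nonneg_left h.2 hc⟩

end Lattice

/-! ### The Archimedean property. -/

section Archimedean

variable {E : Type u} [ConditionallyCompleteLattice E] [AddCommGroup E] [IsOrderedAddMonoid E]

/-- A Dedekind complete Riesz space is Archimedean. -/
theorem nonpos_of_nsmul_le {a b : E} (h : ∀ n : ℕ, n • a ≤ b) : a ≤ 0 := by
  set S : Set E := Set.range fun n : ℕ => n • a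
  have hS : BddAbove S := ⟨b, by rintro _ ⟨n, rfl⟩; exact h n⟩
  -- The multiples of `a` shifted by `a` are again multiples of `a`.
  have : sSup S ≤ sSup S - a := csSup_le (Set.range_nonempty _) (by
    rintro _ ⟨n, rfl⟩
    rw [le_sub_iff_add_le, ← succ_nsmul]
    exact le_csSup hS ⟨n + 1, rfl⟩)
  simpa using this

theorem nonpos_of_le_inv_smul [Module ℝ E] [IsOrderedModule ℝ E] {a b : E} (hb : 0 ≤ b)
    (h : ∀ n : ℕ, a ≤ ((n : ℝ) + 1)⁻¹ • b) : a ≤ 0 := by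
  refine nonpos_of_nsmul_le (b := b) fun n => ?_
  obtain _ | n := n
  · simpa using hb
  have hn : (0 : ℝ) < (n : ℝ) + 1 := by positivity
  have := smul_le_smul_of_nonneg_left (h n) hn.le
  rw [smul_smul, mul_inv_cancel₀ hn.ne', one_smul] at this
  rwa [← Nat.cast_smul_eq_nsmul ℝ, Nat.cast_succ]

end Archimedean

/-! ### Rigidity of band preserving maps. -/

section Orthomorphism

variable {E : Type u} [ConditionallyCompleteLattice E] [AddCommGroup E] [IsOrderedAddMonoid E]
  [Module ℝ E] [IsOrderedModule ℝ E]

/-- Truncating `a` to the interval `[-s, s]` removes the part of `a` above `s` and the part below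
`-s`. -/
theorem abs_sub_excess_le {a s : E} (hs : 0 ≤ s) :
    |a - ((a - s) ⊔ 0 - (-s - a) ⊔ 0)| ≤ s := by
  have h : a - ((a - s) ⊔ 0 - (-s - a) ⊔ 0) = (a ⊓ s) ⊔ (-s) := by
    have h1 : (a - s) ⊔ 0 = a - a ⊓ s := by rw [sub_inf, sub_self, sup_comm]
    have h2 : (a ⊓ s) ⊔ (-s) = a ⊓ s + (-s - a) ⊔ 0 := by
      have h3 : (-s - a ⊓ s) ⊔ 0 = (-s - a) ⊔ 0 := by
        rw [sub_inf, sup_assoc]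
        congr 1
        exact sup_eq_right.2 ((sub_nonpos.2 ((neg_nonpos.2 hs).trans hs)))
      rw [← h3, add_sup, add_sub_cancel, add_zero, sup_comm]
    rw [h1, h2]
    abel
  rw [h]
  exact abs_le'.2 ⟨sup_le inf_le_right ((neg_nonpos.2 hs).trans hs), neg_le.1 le_sup_right⟩

/-- A linear map that is band preserving and bounded by `b` on the order interval of `e`, on a
Riesz subspace `W`. -/
structure IsLocalOn (W : Submodule ℝ E) (e b : E) (D : E →ₗ[ℝ] E) : Prop where
  -- Here `y` ranges over all of `E`, since `D x` may leave `W`.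
  disjoint : ∀ x ∈ W, ∀ y : E, |x| ⊓ |y| = 0 → |D x| ⊓ |y| = 0
  bounded : ∀ x ∈ W, |x| ≤ e → |D x| ≤ b

variable {W : Submodule ℝ E} {e b : E} {D : E →ₗ[ℝ] E}

/-- The part of `|D x|` above `c • b` is carried by the part of `x` above `k • c • e`, for all
`k`. -/
theorem IsLocalOn.excess_inf_eq_zero (hD : IsLocalOn W e b D)
    (hW : ∀ x ∈ W, ∀ y ∈ W, x ⊔ y ∈ W) (heW : e ∈ W) (he : 0 ≤ e) (hb : 0 ≤ b) (hDe : D e = 0)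
    {x : E} (hxW : x ∈ W) (hx : 0 ≤ x) {c : ℝ} (hc : 0 < c) (k : ℕ) :
    ∀ w : E, 0 ≤ w → ((x - k • c • e) ⊔ 0) ⊓ w = 0 → ((|D x| - c • b) ⊔ 0) ⊓ w = 0 := by
  have hs : 0 ≤ c • e := smul_nonneg hc.le he
  have hsW : c • e ∈ W := W.smul_mem c heW
  have hDs : D (c • e) = 0 := by rw [map_smul, hDe, smul_zero]
  have hdDx : (|D x| - c • b) ⊔ 0 ≤ |D x| :=
    sup_le (sub_le_self _ (smul_nonneg hc.le hb)) (abs_nonneg _)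
  induction k with
  | zero =>
    intro w hw h
    rw [zero_smul, sub_zero, sup_of_le_left hx] at h
    have := hD.disjoint x hxW w (by rwa [abs_of_nonneg hx, abs_of_nonneg hw])
    rw [abs_of_nonneg hw] at this
    exact inf_eq_zero_of_le le_sup_right hw hdDx le_rfl this
  | succ k ih =>
    intro w hw h
    set s := c • e
    set d := (|D x| - c • b) ⊔ 0
    set a := x - k • s
    have haW : a ∈ W := W.sub_mem hxW (W.smul_of_tower_mem k hsW)
    have hd : 0 ≤ d := le_sup_right
    have hv : 0 ≤ d ⊓ w := le_inf hd hw
    -- Subtracting `p - q` truncates `a` to `[-s, s]`, where `D` is bounded by `c • b`. So `d ≤ |D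
    -- p| + |D q|`, and it remains to see that `d ⊓ w` is disjoint from `p` and `q`.
    set p := (a - s) ⊔ 0
    set q := (-s - a) ⊔ 0
    have hpW : p ∈ W := hW _ (W.sub_mem haW hsW) _ W.zero_mem
    have hqW : q ∈ W := hW _ (W.sub_mem (W.neg_mem hsW) haW) _ W.zero_mem
    have hp : 0 ≤ p := le_sup_right
    have hq : 0 ≤ q := le_sup_right
    have hpa : (x - (k + 1) • s) ⊔ 0 = p := by
      simp only [p, a, succ_nsmul, sub_sub]
    have hpv : p ⊓ (d ⊓ w) = 0 := inf_eq_zero_of_le hp hv le_rfl inf_le_right (hpa ▸ h)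
    -- Induction hypothesis at `q`, which lies below the negative part of `a = x - k • s`.
    have hdq : d ⊓ q = 0 := by
      refine ih q hq ?_
      refine inf_eq_zero_of_le le_sup_right hq le_rfl (sup_le_sup_right ?_ 0)
        (posPart_inf_negPart_eq_zero a)
      simpa using hs
    have hqv : q ⊓ (d ⊓ w) = 0 :=
      inf_eq_zero_of_le hq hv le_rfl inf_le_left (by rwa [inf_comm])
    have hDp := hD.disjoint p hpW (d ⊓ w) (by rwa [abs_of_nonneg hp, abs_of_nonneg hv])
    have hDq := hD.disjoint q hqW (d ⊓ w) (by rwa [abs_of_nonneg hq, abs_of_nonneg hv])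
    rw [abs_of_nonneg hv] at hDp hDq
    set y := a - (p - q)
    have hyW : y ∈ W := W.sub_mem haW (W.sub_mem hpW hqW)
    have hys : |y| ≤ s := abs_sub_excess_le hs
    have hDy : |D y| ≤ c • b := by
      have h1 : |c⁻¹ • y| ≤ e := by
        have := abs_smul_le_smul (inv_pos.2 hc).le hys
        rwa [inv_smul_smul₀ hc.ne'] at this
      have h2 := abs_smul_le_smul hc.le (hD.bounded _ (W.smul_mem _ hyW) h1)
      rwa [map_smul, smul_inv_smul₀ hc.ne'] at h2
    have hDx : D x = D y + (D p - D q) := by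
      have hx' : x = y + (p - q) + k • s := by simp [y, a]
      conv_lhs => rw [hx']
      rw [map_add, map_nsmul, hDs, smul_zero, add_zero, map_add, map_sub D p q]
    have hdle : d ≤ |D p| + |D q| := by
      refine sup_le ?_ (add_nonneg (abs_nonneg _) (abs_nonneg _))
      rw [sub_le_iff_le_add', hDx]
      refine (abs_add_le _ _).trans (add_le_add hDy ?_)
      rw [sub_eq_add_neg, ← abs_neg (D q)]
      exact abs_add_le _ _
    have hfin := inf_eq_zero_of_le hd hv hdle le_rfl
      (add_inf_eq_zero (abs_nonneg _) (abs_nonneg _) hv hDp hDq)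
    rwa [← inf_assoc, inf_idem] at hfin

/-- A local map that vanishes at `e` vanishes at all positive elements bounded by a multiple of
`e`. -/
theorem IsLocalOn.eq_zero_of_le (hD : IsLocalOn W e b D)
    (hW : ∀ x ∈ W, ∀ y ∈ W, x ⊔ y ∈ W) (heW : e ∈ W) (he : 0 ≤ e) (hb : 0 ≤ b) (hDe : D e = 0)
    {x : E} (hxW : x ∈ W) (hx : 0 ≤ x) {N : ℕ} (hN : x ≤ N • e) : D x = 0 := by
  have h : |D x| ≤ 0 := by
    refine nonpos_of_le_inv_smul hb fun m => ?_
    have hm : (0 : ℝ) < (m : ℝ) + 1 := by positivity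
    -- With `c = 1/(m+1)` and `k = N(m+1)`, `k • c • e = N • e`, so `x` has no excess; testing the
    -- excess of `|D x|` against itself gives `|D x| ≤ c • b`.
    have hd := hD.excess_inf_eq_zero hW heW he hb hDe hxW hx (inv_pos.2 hm) (N * (m + 1))
      ((|D x| - ((m : ℝ) + 1)⁻¹ • b) ⊔ 0) le_sup_right (by
        have : (N * (m + 1)) • ((m : ℝ) + 1)⁻¹ • e = N • e := by
          rw [mul_smul, ← Nat.cast_smul_eq_nsmul ℝ (m + 1), smul_smul, Nat.cast_succ,
            mul_inv_cancel₀ hm.ne', one_smul]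
        rw [this, sup_of_le_right (sub_nonpos.2 hN)]
        exact inf_of_le_left le_sup_right)
    rw [inf_idem] at hd
    exact sub_nonpos.1 (hd ▸ le_sup_left)
  exact eq_zero_of_abs_nonpos h

theorem IsOrthomorphism.sub {π ρ : E →ₗ[ℝ] E} (hπ : IsOrthomorphism π) (hρ : IsOrthomorphism ρ) :
    IsOrthomorphism (π - ρ) where
  order_bounded a := by
    obtain ⟨b, hb⟩ := hπ.order_bounded a
    obtain ⟨c, hc⟩ := hρ.order_bounded a
    refine ⟨b + c, fun x hx => ?_⟩
    rw [LinearMap.sub_apply, sub_eq_add_neg]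
    refine (abs_add_le _ _).trans (add_le_add (hb x hx) ?_)
    rw [abs_neg]
    exact hc x hx
  band_preserving x y h := by
    rw [LinearMap.sub_apply, sub_eq_add_neg]
    refine inf_eq_zero_of_le (abs_nonneg _) (abs_nonneg _) (abs_add_le _ _) le_rfl
      (add_inf_eq_zero (abs_nonneg _) (abs_nonneg _) (abs_nonneg _) (hπ.band_preserving x y h) ?_)
    rw [abs_neg]
    exact hρ.band_preserving x y h

theorem IsOrthomorphism.exists_isLocalOn (hD : IsOrthomorphism D) (W : Submodule ℝ E) {e : E}
    (he : 0 ≤ e) : ∃ b, 0 ≤ b ∧ IsLocalOn W e b D := by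
  obtain ⟨b, hb⟩ := hD.order_bounded e
  exact ⟨b, (abs_nonneg _).trans (hb 0 (by simpa using he)),
    fun x _ y => hD.band_preserving x y, fun x _ => hb x⟩

/-- An orthomorphism that vanishes at a weak order unit vanishes. -/
theorem IsOrthomorphism.eq_zero (hD : IsOrthomorphism D) (he : IsWeakOrderUnit e)
    (hDe : D e = 0) : D = 0 := by
  have hpos : ∀ x : E, 0 ≤ x → D x = 0 := by
    intro x hx
    obtain ⟨b, hb, hloc⟩ := hD.exists_isLocalOn ⊤ he.1
    refine he.2 _ (le_antisymm ?_ (le_inf (abs_nonneg _) he.1))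
    -- `D` kills the part of `x` below `(n+1) • e`, so `D x` is disjoint from `q = ((n+1) • e -
    -- x)⁺`; as `e ≤ c • q + c • x`, only `c • x` contributes to `|D x| ⊓ e`.
    refine nonpos_of_le_inv_smul hx fun n => ?_
    set c : ℝ := ((n : ℝ) + 1)⁻¹
    have hn : (0 : ℝ) < (n : ℝ) + 1 := by positivity
    have hc : 0 < c := inv_pos.2 hn
    have h1 : D x = D ((x - (n + 1) • e) ⊔ 0) := by
      have h2 : D (x ⊓ (n + 1) • e) = 0 :=
        hloc.eq_zero_of_le (fun _ _ _ _ => trivial) trivial he.1 hb hDe trivial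
          (le_inf hx (nsmul_nonneg he.1 _)) inf_le_right
      have h3 : (x - (n + 1) • e) ⊔ 0 = x - x ⊓ (n + 1) • e := by
        rw [sub_inf, sub_self, sup_comm]
      rw [h3, map_sub, h2, sub_zero]
    set q := ((n + 1) • e - x) ⊔ 0
    have hq : 0 ≤ q := le_sup_right
    have h4 : |D x| ⊓ q = 0 := by
      rw [h1, ← abs_of_nonneg hq]
      refine hD.band_preserving _ _ ?_
      rw [abs_of_nonneg hq, abs_of_nonneg le_sup_right]
      have := posPart_inf_negPart_eq_zero (x - (n + 1) • e)
      rwa [negPart_def, neg_sub, posPart_def] at this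
    have hc1 : c ≤ 1 := inv_le_one_of_one_le₀ (by simp)
    have hcq : c • q ≤ q := by simpa using smul_le_smul_of_nonneg_right hc1 hq
    have h5 : c • q ⊓ (|D x| ⊓ e) = 0 :=
      inf_eq_zero_of_le (smul_nonneg hc.le hq) (le_inf (abs_nonneg _) he.1) hcq inf_le_left
        (by rwa [inf_comm])
    have h6 : e ≤ c • q + c • x := by
      rw [← smul_add]
      have h7 : (n + 1) • e ≤ q + x := sub_le_iff_le_add.1 le_sup_left
      have h8 := smul_le_smul_of_nonneg_left h7 hc.le
      rwa [← Nat.cast_smul_eq_nsmul ℝ (n + 1), Nat.cast_succ, inv_smul_smul₀ hn.ne'] at h8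
    calc |D x| ⊓ e = (c • q + c • x) ⊓ (|D x| ⊓ e) :=
          (inf_of_le_right (inf_le_right.trans h6)).symm
      _ ≤ c • q ⊓ (|D x| ⊓ e) + c • x ⊓ (|D x| ⊓ e) :=
          add_inf_le_inf_add_inf (smul_nonneg hc.le hq) (smul_nonneg hc.le hx)
            (le_inf (abs_nonneg _) he.1)
      _ ≤ c • x := by rw [h5, zero_add]; exact inf_le_left
  ext x
  have := hpos (x ⊔ 0) le_sup_right
  have h2 := hpos ((-x) ⊔ 0) le_sup_right
  have h3 : x = x ⊔ 0 - (-x) ⊔ 0 := (posPart_sub_negPart x).symm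
  rw [h3, map_sub, this, h2, sub_self, LinearMap.zero_apply]

end Orthomorphism

/-! ### Multiplication by elements of `[0, e]`. -/

section Multiplication

variable {E : Type u} [ConditionallyCompleteLattice E] [AddCommGroup E] [IsOrderedAddMonoid E]
  [Module ℝ E] [IsOrderedModule ℝ E]

theorem map_mono_of_nonneg {T : E →ₗ[ℝ] E} (hT : ∀ x, 0 ≤ x → 0 ≤ T x) {x y : E} (h : x ≤ y) :
    T x ≤ T y := by
  have := hT (y - x) (sub_nonneg.2 h)
  rwa [map_sub, sub_nonneg] at this

theorem abs_map_le {T : E →ₗ[ℝ] E} (hT : ∀ x, 0 ≤ x → 0 ≤ T x) (x : E) : |T x| ≤ T |x| :=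
  abs_le'.2 ⟨map_mono_of_nonneg hT (le_abs_self x),
    by rw [← map_neg]; exact map_mono_of_nonneg hT (neg_le_abs x)⟩

/-- An operator between `0` and the identity is an orthomorphism. -/
theorem isOrthomorphism_of_le_id {π : E →ₗ[ℝ] E} (h0 : ∀ x, 0 ≤ x → 0 ≤ π x)
    (h1 : ∀ x, 0 ≤ x → π x ≤ x) : IsOrthomorphism π := by
  have h : ∀ x, |π x| ≤ |x| := fun x => (abs_map_le h0 x).trans (h1 _ (abs_nonneg x))
  exact ⟨fun a => ⟨a, fun x hx => (h x).trans hx⟩, fun x y hxy =>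
    inf_eq_zero_of_le (abs_nonneg _) (abs_nonneg _) (h x) le_rfl hxy⟩

/-- Multiplication by an element `f` of the order interval `[0, e]` exists. -/
theorem exists_isOrthomorphism_apply_eq {e f : E} (hf : 0 ≤ f) (hfe : f ≤ e) :
    ∃ π : E →ₗ[ℝ] E, IsOrthomorphism π ∧ π e = f := by
  have H : ∀ c : ℝ, c • e = 0 → c • f = 0 := by
    intro c hc
    rcases smul_eq_zero.1 hc with rfl | rfl
    · exact zero_smul _ _
    · rw [le_antisymm hfe hf, smul_zero]
  -- Domination by `x ⊔ 0`, read at `-x` and at `x`, forces `0 ≤ π x ≤ x` for `x ≥ 0`.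
  obtain ⟨π, hπ, hle⟩ := exists_extension_of_le_sublinear_lattice
    (LinearPMap.mkSpanSingleton' (σ := RingHom.id ℝ) e f H) (fun x => x ⊔ 0)
    (fun c hc x => by
      have h : c • (x ⊔ 0) = c • x ⊔ c • 0 := (OrderIso.smulRight (β := E) hc).map_sup x 0
      rw [h, smul_zero])
    (fun x y => sup_le (add_le_add le_sup_left le_sup_left)
      (add_nonneg le_sup_right le_sup_right)) (by
      rintro ⟨x, hx⟩
      obtain ⟨c, rfl⟩ := Submodule.mem_span_singleton.1 hx
      rw [LinearPMap.mkSpanSingleton'_apply, RingHom.id_apply]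
      rcases le_total 0 c with hc | hc
      · exact (smul_le_smul_of_nonneg_left hfe hc).trans le_sup_left
      · exact (smul_nonpos_of_nonpos_of_nonneg hc hf).trans le_sup_right)
  refine ⟨π, isOrthomorphism_of_le_id (fun x hx => ?_) (fun x hx => ?_), ?_⟩
  · have := hle (-x)
    rw [map_neg, sup_of_le_right (neg_nonpos.2 hx)] at this
    exact neg_nonpos.1 this
  · exact (hle x).trans_eq (sup_of_le_left hx)
  · have h1 := hπ ⟨e, Submodule.mem_span_singleton_self e⟩
    rw [h1]
    have h2 := LinearPMap.mkSpanSingleton'_apply (σ := RingHom.id ℝ) e f H 1 (by simp)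
    simpa using h2

theorem existsUnique_isOrthomorphism_apply_eq {e f : E} (he : IsWeakOrderUnit e) (hf : 0 ≤ f)
    (hfe : f ≤ e) : ∃! π : E →ₗ[ℝ] E, IsOrthomorphism π ∧ π e = f := by
  obtain ⟨π, hπ, hπe⟩ := exists_isOrthomorphism_apply_eq hf hfe
  refine ⟨π, ⟨hπ, hπe⟩, fun ρ hρ => ?_⟩
  exact sub_eq_zero.1 ((hρ.1.sub hπ).eq_zero he (by rw [LinearMap.sub_apply, hρ.2, hπe, sub_self]))

theorem fMul_eq {e f : E} (hf : 0 ≤ f) (hfe : f ≤ e) :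
    ∃ π : E →ₗ[ℝ] E, IsOrthomorphism π ∧ π e = f ∧ ∀ g, fMul e f g = π g := by
  have h := exists_isOrthomorphism_apply_eq hf hfe
  exact ⟨h.choose, h.choose_spec.1, h.choose_spec.2, fun g => by rw [fMul, dif_pos h]⟩

end Multiplication

/-! ### Band projections, commutation and averaging. -/

section BandProjection

variable {E : Type u} [ConditionallyCompleteLattice E] [AddCommGroup E] [IsOrderedAddMonoid E]
  [Module ℝ E] [IsOrderedModule ℝ E] {P : E →ₗ[ℝ] E}

/-- Disjointness gives `|x - P x| + |P x| ≤ x = (x - P x) + P x`, so both summands equal their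
moduli. -/
theorem IsBandProjection.nonneg_and_le (hP : IsBandProjection P) {x : E} (hx : 0 ≤ x) :
    0 ≤ P x ∧ P x ≤ x := by
  obtain ⟨B, hB, h⟩ := hP
  have h1 := abs_add_of_disjoint ((h x).2 _ (h x).1)
  rw [sub_add_cancel, abs_of_nonneg hx] at h1
  have h2 : |x - P x| + |P x| = (x - P x) + P x :=
    le_antisymm (h1.trans_eq (sub_add_cancel _ _).symm)
      (add_le_add (le_abs_self _) (le_abs_self _))
  constructor
  · have : |P x| ≤ P x := by
      have := h2.le.trans (add_le_add_left (le_abs_self (x - P x)) _)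
      exact le_of_add_le_add_left this
    exact (abs_nonneg _).trans this
  · have : |x - P x| ≤ x - P x := by
      have := h2.le.trans (add_le_add_right (le_abs_self (P x)) _)
      exact le_of_add_le_add_right this
    exact sub_nonneg.1 ((abs_nonneg _).trans this)

theorem IsBandProjection.apply_eq_self (hP : IsBandProjection P) {x y : E} (hy : 0 ≤ y)
    (hyx : y ≤ P x) : P y = y := by
  obtain ⟨B, hB, h⟩ := hP
  have hyB : y ∈ B := hB.solid _ (h x).1 y (by
    rw [abs_of_nonneg hy]; exact hyx.trans (le_abs_self _))
  exact (sub_eq_zero.1 (eq_zero_of_inf_self ((h y).2 _ (B.sub_mem hyB (h y).1)))).symm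

theorem IsBandProjection.apply_eq_zero (hP : IsBandProjection P) {x z : E} (hz : 0 ≤ z)
    (hzx : z ≤ x - P x) : P z = 0 := by
  obtain ⟨h0, h1⟩ := hP.nonneg_and_le hz
  obtain ⟨B, hB, h⟩ := hP
  have h2 := (h x).2 _ (h z).1
  refine eq_zero_of_inf_self (inf_eq_zero_of_le (abs_nonneg _) (abs_nonneg _) ?_ le_rfl h2)
  rw [abs_of_nonneg h0]
  exact (h1.trans hzx).trans (le_abs_self _)

/-- A positive operator `U` that fixes `e` and `P e` commutes with the band projection `P` on the
order interval `[0, e]`. -/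
theorem IsBandProjection.comm_of_map_eq (hP : IsBandProjection P) {U : E →ₗ[ℝ] E}
    (hU : ∀ x, 0 ≤ x → 0 ≤ U x) {e : E} (hUe : U e = e) (hUP : U (P e) = P e) {x : E}
    (hx : 0 ≤ x) (hxe : x ≤ e) : U (P x) = P (U x) := by
  have hmono := fun {x y : E} (h : x ≤ y) => map_mono_of_nonneg hU h
  have hPmono := fun {x y : E} (h : x ≤ y) =>
    map_mono_of_nonneg (fun x hx => (hP.nonneg_and_le hx).1) h
  obtain ⟨h0, h1⟩ := hP.nonneg_and_le hx
  -- `U` maps `[0, P e]` into itself, and likewise `[0, e - P e]`, so it respects the splitting of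
  -- `x`.
  have h2 : P (U (P x)) = U (P x) :=
    hP.apply_eq_self (x := e) (hU _ h0) ((hmono (hPmono hxe)).trans_eq hUP)
  have h3 : P (U (x - P x)) = 0 := by
    refine hP.apply_eq_zero (x := e) (hU _ (sub_nonneg.2 h1)) ?_
    have h4 := (hP.nonneg_and_le (sub_nonneg.2 hxe)).2
    have h5 : x - P x ≤ e - P e := by
      rw [map_sub] at h4
      rw [← sub_nonneg]
      have := sub_nonneg.2 h4
      rwa [sub_sub_sub_comm]
    exact (hmono h5).trans_eq (by rw [map_sub, hUe, hUP])
  rw [map_sub, map_sub, h2] at h3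
  exact (sub_eq_zero.1 h3).symm

/-- The averaging property of `T`: for `h` in the range of `T`, the operator `T P` acts as
multiplication by `T P e`. -/
theorem fMul_map_bandProjection {T : E →ₗ[ℝ] E} (hT : IsConditionalExpectation T)
    (hP : IsBandProjection P) {e : E} (he : 0 ≤ e) (hTe : T e = e) {h : E}
    (hh : h ∈ LinearMap.range T) (h0 : 0 ≤ h) (hhe : h ≤ e) :
    fMul e (T (P e)) h = T (P h) := by
  have hPe := hP.nonneg_and_le he
  have hPpos : ∀ x, 0 ≤ x → 0 ≤ P x := fun x hx => (hP.nonneg_and_le hx).1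
  have hTid : ∀ x ∈ LinearMap.range T, T x = x := by
    rintro _ ⟨y, rfl⟩
    exact hT.idempotent y
  obtain ⟨π, hπ, hπe, hfMul⟩ := fMul_eq (hT.positive _ hPe.1)
    ((map_mono_of_nonneg hT.positive hPe.2).trans_eq hTe)
  have habs : ∀ x ∈ LinearMap.range T, |x| ∈ LinearMap.range T := fun x hx =>
    hT.range_sup_mem x hx _ (Submodule.neg_mem _ hx)
  -- `T` fixes `|x|` for `x` in its range, so `T P` preserves disjointness there; this is why
  -- locality is only asked on a subspace.
  have hTP : ∀ x ∈ LinearMap.range T, |T (P x)| ≤ |x| := fun x hx =>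
    calc |T (P x)| ≤ T |P x| := abs_map_le hT.positive _
      _ ≤ T (P |x|) := map_mono_of_nonneg hT.positive (abs_map_le hPpos x)
      _ ≤ T |x| := map_mono_of_nonneg hT.positive (hP.nonneg_and_le (abs_nonneg x)).2
      _ = |x| := hTid _ (habs x hx)
  obtain ⟨b, hb, hloc⟩ := hπ.exists_isLocalOn (LinearMap.range T) he
  have hD : IsLocalOn (LinearMap.range T) e (b + e) (π - T ∘ₗ P) := by
    have hle : ∀ x, |(π - T ∘ₗ P) x| ≤ |π x| + |T (P x)| := fun x => by
      rw [LinearMap.sub_apply, sub_eq_add_neg, LinearMap.comp_apply, ← abs_neg (T (P x))]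
      exact abs_add_le _ _
    constructor
    · intro x hx y hxy
      exact inf_eq_zero_of_le (abs_nonneg _) (abs_nonneg _) (hle x) le_rfl
        (add_inf_eq_zero (abs_nonneg _) (abs_nonneg _) (abs_nonneg _) (hloc.disjoint x hx y hxy)
          (inf_eq_zero_of_le (abs_nonneg _) (abs_nonneg _) (hTP x hx) le_rfl hxy))
    · intro x hx hxe
      exact (hle x).trans (add_le_add (hloc.bounded x hx hxe) ((hTP x hx).trans hxe))
  have := hD.eq_zero_of_le hT.range_sup_mem ⟨e, hTe⟩ he (add_nonneg hb he)
    (by rw [LinearMap.sub_apply, hπe, LinearMap.comp_apply, sub_self]) hh h0 (N := 1)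
    (by rwa [one_smul])
  rw [hfMul]
  exact sub_eq_zero.1 this

end BandProjection

end RieszMixing

/-! ### The mixing inequality. -/

/-- On a `T`-universally complete Riesz space, `α_T(U, V) ≤ φ_T(U, V)`.  The first four conjuncts
say that the products, norms and suprema in the two coefficients really exist. -/
theorem theorem4p6 {E : Type u} [ConditionallyCompleteLattice E] [AddCommGroup E]
    [IsOrderedAddMonoid E] [Module ℝ E] [IsOrderedModule ℝ E]
    (T : E →ₗ[ℝ] E) (hT : IsConditionalExpectation T) (hE : IsTUniversallyComplete T)
    (e : E) (he : IsWeakOrderUnit e) (hTe : T e = e)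
    (U V : E →ₗ[ℝ] E) (hU : IsCompatible T U) (hV : IsCompatible T V) :
    (∀ P ∈ bandProjections e U, ∃! π : E →ₗ[ℝ] E, IsOrthomorphism π ∧ π e = T (P e)) ∧
    (∀ Q ∈ bandProjections e V, U (Q e) - T (Q e) ∈ LInfty T) ∧
    IsLUB (strongMixingSet e T U V) (strongMixing e T U V) ∧
    IsLUB (uniformMixingSet e T U V) (uniformMixing e T U V) ∧
    strongMixing e T U V ≤ uniformMixing e T U V := by
  have hUpos := hU.conditionalExpectation.positive
  have hTU : ∀ x, T (U x) = T x := fun x => LinearMap.congr_fun hU.comp_left x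
  have hUe : U e = e := by
    have := LinearMap.congr_fun hU.comp_right e
    rwa [LinearMap.comp_apply, hTe] at this
  have heT : e ∈ LinearMap.range T := ⟨e, hTe⟩
  have unit_interval : ∀ {S : E →ₗ[ℝ] E}, (∀ x, 0 ≤ x → 0 ≤ S x) → S e = e → ∀ {P : E →ₗ[ℝ] E},
      IsBandProjection P → 0 ≤ S (P e) ∧ S (P e) ≤ e := fun hS hSe _ hP =>
    ⟨hS _ (hP.nonneg_and_le he.1).1,
      (map_mono_of_nonneg hS (hP.nonneg_and_le he.1).2).trans_eq hSe⟩
  have hdiff : ∀ Q ∈ bandProjections e V, |U (Q e) - T (Q e)| ≤ e := by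
    intro Q hQ
    obtain ⟨hU0, hU1⟩ := unit_interval hUpos hUe hQ.1
    obtain ⟨hT0, hT1⟩ := unit_interval hT.positive hTe hQ.1
    exact abs_le'.2 ⟨(sub_le_self _ hT0).trans hU1, by
      rw [neg_sub]; exact (sub_le_self _ hU0).trans hT1⟩
  have hnorm_bdd : ∀ f : E, BddBelow {g | g ∈ LinearMap.range T ∧ 0 ≤ g ∧ |f| ≤ g} :=
    fun f => ⟨0, fun g hg => hg.2.1⟩
  -- The projection onto the zero band makes both sets of coefficients nonempty.
  have hzero : ∀ S : E →ₗ[ℝ] E, (0 : E →ₗ[ℝ] E) ∈ bandProjections e S := fun S =>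
    ⟨⟨⊥, ⟨fun x hx y hy => by
        rw [Submodule.mem_bot] at hx ⊢
        rw [hx, abs_zero] at hy
        exact eq_zero_of_abs_nonpos hy, fun S hne hS s hs => by
        have : S = {0} := hne.subset_singleton_iff.1 fun x hx => by simpa using hS hx
        rw [this] at hs
        exact (Submodule.mem_bot ℝ).2 (hs.unique isLUB_singleton)⟩,
      fun x => ⟨Submodule.zero_mem _, fun y hy => by
        rw [(Submodule.mem_bot ℝ).1 hy, abs_zero]
        exact inf_of_le_right (abs_nonneg _)⟩⟩, Submodule.zero_mem _⟩
  have huniform : IsLUB (uniformMixingSet e T U V) (uniformMixing e T U V) := by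
    refine isLUB_csSup ⟨_, 0, hzero V, rfl⟩ ⟨e, ?_⟩
    rintro _ ⟨Q, hQ, rfl⟩
    exact csInf_le (hnorm_bdd _) ⟨heT, he.1, hdiff Q hQ⟩
  have hle : ∀ x ∈ strongMixingSet e T U V, x ≤ uniformMixing e T U V := by
    rintro _ ⟨P, hP, Q, hQ, rfl⟩
    refine le_trans ?_ (huniform.1 ⟨Q, hQ, rfl⟩)
    refine le_csInf ⟨e, heT, he.1, hdiff Q hQ⟩ ?_
    rintro _ ⟨⟨g, rfl⟩, hg0, hg⟩
    obtain ⟨hT0, hT1⟩ := unit_interval hT.positive hTe hQ.1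
    obtain ⟨hQ0, hQ1⟩ := hQ.1.nonneg_and_le he.1
    have hUP : U (P e) = P e := by
      obtain ⟨y, hy⟩ := hP.2
      rw [← hy, hU.conditionalExpectation.idempotent]
    have hPpos : ∀ x, 0 ≤ x → 0 ≤ P x := fun x hx => (hP.1.nonneg_and_le hx).1
    -- Both terms take the form `T (P _)`: averaging for the product, inserting `U` and commuting it
    -- past `P` for the other.
    rw [fMul_map_bandProjection hT hP.1 he.1 hTe ⟨Q e, rfl⟩ hT0 hT1, ← hTU (P (Q e)),
      hP.1.comm_of_map_eq hUpos hUe hUP hQ0 hQ1, ← map_sub, ← map_sub]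
    calc |T (P (U (Q e) - T (Q e)))| ≤ T |P (U (Q e) - T (Q e))| := abs_map_le hT.positive _
      _ ≤ T (P |U (Q e) - T (Q e)|) := map_mono_of_nonneg hT.positive (abs_map_le hPpos _)
      _ ≤ T |U (Q e) - T (Q e)| :=
        map_mono_of_nonneg hT.positive (hP.1.nonneg_and_le (abs_nonneg _)).2
      _ ≤ T (T g) := map_mono_of_nonneg hT.positive hg
      _ = T g := hT.idempotent g
  have hstrong : IsLUB (strongMixingSet e T U V) (strongMixing e T U V) :=
    isLUB_csSup ⟨_, 0, hzero U, 0, hzero V, rfl⟩ ⟨_, hle⟩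
  refine ⟨fun P hP => ?_, fun Q hQ => ⟨e, heT, he.1, hdiff Q hQ⟩, hstrong, huniform, hstrong.2 hle⟩
  obtain ⟨h0, h1⟩ := unit_interval hT.positive hTe hP.1
  exact existsUnique_isOrthomorphism_apply_eq he h0 h1
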